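/- Let $K_n=(V_n,E_n)$ be the complete graph on $n$ nodes, one of which is labelled $1$. For $S\subseteq V_n$ let $\delta(S)\subseteq E_n$ be the set of edges with exactly one end in $S$, write $\delta(v)=\delta(\{v\})$, and write $x(F)=\sum_{e\in F}x_e$ for $x\in\mathbb{R}^{E_n}$, $F\subseteq E_n$. Let $S^n$ be the subtour elimination polytope, that is, the set of all $x\in\mathbb{R}^{E_n}$ with $x(\delta(v))=2$ for all $v\in V_n$, $x(\delta(S))\ge 2$ for all $\emptyset\ne S\subsetneq V_n$, and $0\le x_e\le 1$ for all $e\in E_n$. A tour is a multiset of edges of $K_n$ (arbitrary multiplicities allowed) that forms a connected multigraph on all of $V_n$ with all degrees even, and $T^n\subseteq\mathbb{R}^{E_n}$ is the convex hull of the incidence vectors (vectors of multiplicities) of tours. A $1$-tree of $K_n$ is a set $F\subseteq E_n$ such that $|F\cap\delta(1)|=2$ and $F\setminus\delta(1)$ is the edge set of a spanning tree on $V_n\setminus\{1\}$. For $x\in S^n$ the support graph is $G_x=(V_n,E_x)$ with $E_x=\{e\in E_n: x_e>0\}$; the point $x$ is $\frac12$-integer if $x_e\in\{0,\frac12,1\}$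 for all $e\in E_n$, and its $\frac12$-edges are the edges $e$ with $x_e=\frac12$. Theorem. Let $x\in S^n$ be $\frac12$-integer. Suppose that (A) the support graph $G_x$ has a Hamiltonian cycle $H$, and (B) for this $H$, $x$ is a convex combination of incidence vectors of $1$-trees of $K_n$, each of which contains an even number of edges of every cut $\delta(S)\cap E_x$ ($S\subseteq V_n$) of $G_x$ that consists of exactly four edges, all of them $\frac12$-edges that belong to $H$. Then $\frac{10}{7}x\in T^n$. -/

import Mathlib

namespace TSP

/-- The edge set `E_n` of the complete graph `K_n` on the node set `V_n = Fin n`. -/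
abbrev Edge (n : ℕ) : Type := {e : Sym2 (Fin n) // ¬ e.IsDiag}

/-- The graph `(V_n, F)` for a set `F` of edges of `K_n`. -/
def edgeGraph {n : ℕ} (F : Set (Edge n)) : SimpleGraph (Fin n) :=
  SimpleGraph.fromEdgeSet (Subtype.val '' F)

/-- The cut `δ(S)` of `K_n`: the edges with one end in `S` and the other one outside `S`. -/
def cut {n : ℕ} (S : Finset (Fin n)) : Finset (Edge n) :=
  Finset.univ.filter fun e => ∃ u ∈ S, ∃ v ∉ S, (e : Sym2 (Fin n)) = s(u, v)

/-- The subtour elimination polytope `S^n`. -/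
def subtourPolytope (n : ℕ) : Set (Edge n → ℝ) :=
  {x | (∀ v : Fin n, ∑ e ∈ cut {v}, x e = 2) ∧
    (∀ S : Finset (Fin n), S.Nonempty → S ≠ Finset.univ → 2 ≤ ∑ e ∈ cut S, x e) ∧
    (∀ e, 0 ≤ x e ∧ x e ≤ 1)}

/-- `x` is ½-integer. -/
def IsHalfInteger {n : ℕ} (x : Edge n → ℝ) : Prop :=
  ∀ e, x e = 0 ∨ x e = 1 / 2 ∨ x e = 1

/-- The edge set `E_x` of the support graph of `x`. -/
noncomputable def supportEdges {n : ℕ} (x : Edge n → ℝ) : Finset (Edge n) :=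
  Finset.univ.filter fun e => 0 < x e

/-- `H` is a Hamiltonian cycle of the graph `(V_n, E)`: a subset of `E` that is the edge set of a
connected spanning subgraph in which every node has degree two. -/
def IsHamiltonianCycle {n : ℕ} (E H : Finset (Edge n)) : Prop :=
  H ⊆ E ∧ (edgeGraph (H : Set (Edge n))).Connected ∧ ∀ v : Fin n, (H ∩ cut {v}).card = 2

/-- `F` is a 1-tree of `K_n`, where `r` is the node labelled `1`: exactly two edges of `F` are
incident with `r`, and the other edges of `F` form a spanning tree on the nodes other than `r`. -/
def IsOneTree {n : ℕ} (r : Fin n) (F : Finset (Edge n)) : Prop :=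
  (F ∩ cut {r}).card = 2 ∧
    ((edgeGraph ((F \ cut {r} : Finset (Edge n)) : Set (Edge n))).induce {v | v ≠ r}).IsTree

/-- The incidence vector of a multiset of edges, given by its multiplicities. -/
def incidenceVector {n : ℕ} (J : Edge n → ℕ) : Edge n → ℝ := fun e => (J e : ℝ)

/-- The multiplicities of a set of edges, seen as a multiset. -/
def setMultiplicity {n : ℕ} (F : Finset (Edge n)) : Edge n → ℕ := fun e => if e ∈ F then 1 else 0

/-- Property (A): the support graph of `x` has the Hamiltonian cycle `H`. -/
def PropertyA {n : ℕ} (x : Edge n → ℝ) (H : Finset (Edge n)) : Prop :=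
  IsHamiltonianCycle (supportEdges x) H

/-- `C` is a cut of the support graph of `x` that consists of four ½-edges, all in `H`. -/
def IsFourHalfEdgeCut {n : ℕ} (x : Edge n → ℝ) (H C : Finset (Edge n)) : Prop :=
  (∃ S : Finset (Fin n), C = supportEdges x ∩ cut S) ∧ C.card = 4 ∧ ∀ e ∈ C, x e = 1 / 2 ∧ e ∈ H

/-- Property (B), with respect to `H` and the node `r` labelled `1`: `x` is a convex combination of
incidence vectors of 1-trees of `K_n`, each of which contains an even number of edges of every cut
of the support graph that consists of four ½-edges in `H`. -/
def PropertyB {n : ℕ} (r : Fin n) (x : Edge n → ℝ) (H : Finset (Edge n)) : Prop :=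
  x ∈ convexHull ℝ {z : Edge n → ℝ | ∃ F : Finset (Edge n), IsOneTree r F ∧
    (∀ C : Finset (Edge n), IsFourHalfEdgeCut x H C → Even (F ∩ C).card) ∧
    z = incidenceVector (setMultiplicity F)}

/-- The multiset of edges with multiplicities `J` is a tour: it forms a connected spanning
multigraph on `V_n` in which every degree is even. -/
def IsTour {n : ℕ} (J : Edge n → ℕ) : Prop :=
  (edgeGraph {e | 0 < J e}).Connected ∧ ∀ v : Fin n, Even (∑ e ∈ cut {v}, J e)

/-- The polyhedron `T^n`: the convex hull of the incidence vectors of tours of `K_n`. -/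
def tourPolyhedron (n : ℕ) : Set (Edge n → ℝ) :=
  convexHull ℝ {z | ∃ J : Edge n → ℕ, IsTour J ∧ z = incidenceVector J}

end TSP

/-!
Write `h` for the incidence vector of the Hamiltonian cycle `H` and let `y = (4x - h) / 6`. Then
`10/7 x = 1/7 h + 6/7 (x + y)`, and `h` is the incidence vector of a tour, so it is enough that
`x + y` lies in the polyhedron of tours.

By Property (B), `x` is a convex combination of incidence vectors of `1`-trees `F`, which are
connected spanning graphs. Let `T` be the set of odd nodes of such an `F`: adding a `T`-join to `F`
gives a tour. The vector `y` covers every cut `δ(S)` that `F` meets in an odd number of edges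
(`TSP.one_le_sum_cut`): both `2x(δ(S)) ≥ 4` and `|H ∩ δ(S)| ≥ 2` are even and
`|H ∩ δ(S)| ≤ 2x(δ(S))`, so `6y(δ(S)) = 4x(δ(S)) - |H ∩ δ(S)|` is at least six unless both are equal
to four. In that case the cut consists of four ½-edges of `H`, and `F` meets it evenly. By the
theorem of Edmonds and Johnson (`TSP.exists_mem_convexHull_join_le`), `y` then dominates a convex
combination of `T`-joins. As the polyhedron of tours is closed upwards
(`TSP.mem_tourPolyhedron_of_le`), it contains the sum of `y` and the incidence vector of `F`.

Most of the file proves the Edmonds-Johnson theorem for `K_n`. By separation, and by rounding the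
coefficients of the separating functional, it reduces to this claim: for costs `c : E_n → ℕ` that
make every circuit even, some `T`-join costs at most `∑ c_e y_e` (`TSP.exists_join_cost_le`). The
proof is an induction on `∑ c_e` in the manner of Sebő's proof of Seymour's theorem on packing
`T`-cuts. Choose nodes `a`, `b` for which a cheapest `(T Δ {a, b})`-join has the smallest cost, and
let `S` be the set of nodes joined to `b` at cost zero. Every cheapest `T`-join has just one edge in
`δ(S)` (`TSP.sum_cut_zeroClass_eq_one`). Hence, by the parity of the costs and by exchanging
circuits that cross `δ(S)` twice, lowering the costs on `δ(S)` by one lowers the smallest cost of a `T`-join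
by at most one (`TSP.cost_le_cost_reduceCost_add_one`), while it lowers `∑ c_e y_e` by
`y(δ(S)) ≥ 1`.
-/

namespace TSP

variable {n : ℕ}

/-! ### Edges, cuts and parities of degrees -/

lemma exists_mk (e : Edge n) : ∃ (u v : Fin n) (h : u ≠ v), e = ⟨s(u, v), by simpa using h⟩ := by
  obtain ⟨e, he⟩ := e
  induction e using Sym2.ind with
  | _ u v => exact ⟨u, v, by simpa using he, rfl⟩

lemma mk_mem_cut {u v : Fin n} (h : ¬ s(u, v).IsDiag) (S : Finset (Fin n)) :
    (⟨s(u, v), h⟩ : Edge n) ∈ cut S ↔ (u ∈ S ∧ v ∉ S) ∨ (v ∈ S ∧ u ∉ S) := by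
  simp only [cut, Finset.mem_filter, Finset.mem_univ, true_and, Sym2.eq_iff]
  constructor
  · rintro ⟨a, ha, b, hb, ⟨rfl, rfl⟩ | ⟨rfl, rfl⟩⟩
    · exact Or.inl ⟨ha, hb⟩
    · exact Or.inr ⟨ha, hb⟩
  · rintro (⟨ha, hb⟩ | ⟨ha, hb⟩)
    · exact ⟨u, ha, v, hb, Or.inl ⟨rfl, rfl⟩⟩
    · exact ⟨v, ha, u, hb, Or.inr ⟨rfl, rfl⟩⟩

lemma mk_mem_cut_singleton {u v : Fin n} (h : ¬ s(u, v).IsDiag) (w : Fin n) :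
    (⟨s(u, v), h⟩ : Edge n) ∈ cut {w} ↔ w = u ∨ w = v := by
  have huv : u ≠ v := by simpa using h
  rw [mk_mem_cut]
  simp only [Finset.mem_singleton]
  grind

/-- Every edge of `δ(S)` can be written with its end in `S` first. -/
lemma exists_mk_of_mem_cut {e : Edge n} {S : Finset (Fin n)} (he : e ∈ cut S) :
    ∃ (s u : Fin n) (h : ¬ s(s, u).IsDiag), s ∈ S ∧ u ∉ S ∧ e = ⟨s(s, u), h⟩ := by
  obtain ⟨s, hs, u, hu, h⟩ := (Finset.mem_filter.1 he).2
  exact ⟨s, u, h ▸ e.2, hs, hu, Subtype.ext h⟩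

/-- Modulo two, the indicator of `δ(S)` is the sum of the indicators of the stars of the nodes
of `S`. -/
lemma cut_indicator (S : Finset (Fin n)) (e : Edge n) :
    (if e ∈ cut S then 1 else 0 : ZMod 2) = ∑ v ∈ S, if e ∈ cut {v} then 1 else 0 := by
  obtain ⟨a, b, hab, rfl⟩ := exists_mk e
  have h : ∀ v ∈ S, (if (⟨s(a, b), by simpa using hab⟩ : Edge n) ∈ cut {v} then 1 else 0 : ZMod 2)
      = (if v = a then 1 else 0) + (if v = b then 1 else 0) := by
    intro v _
    simp only [mk_mem_cut_singleton]
    by_cases h1 : v = a <;> by_cases h2 : v = b <;> simp_all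
  rw [Finset.sum_congr rfl h, Finset.sum_add_distrib, Finset.sum_ite_eq', Finset.sum_ite_eq']
  simp only [mk_mem_cut]
  by_cases h1 : a ∈ S <;> by_cases h2 : b ∈ S <;> simp [h1, h2]
  decide

/-- The set of nodes of odd degree in a set of edges. Both sets are given by their indicators
modulo two, so that the symmetric difference is addition and this map is linear. -/
def boundary : (Edge n → ZMod 2) →ₗ[ZMod 2] (Fin n → ZMod 2) :=
  LinearMap.pi fun v => ∑ e ∈ cut {v}, LinearMap.proj e

lemma boundary_apply (J : Edge n → ZMod 2) (v : Fin n) :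
    boundary J v = ∑ e ∈ cut {v}, J e := by
  simp [boundary]

lemma boundary_single {u v : Fin n} (h : ¬ s(u, v).IsDiag) :
    boundary (Pi.single (⟨s(u, v), h⟩ : Edge n) 1) = Pi.single u 1 + Pi.single v 1 := by
  have huv : u ≠ v := by simpa using h
  funext w
  rw [boundary_apply]
  simp only [Pi.single_apply, Finset.sum_ite_eq', mk_mem_cut_singleton, Pi.add_apply]
  by_cases h1 : w = u <;> by_cases h2 : w = v <;> simp_all

/-- A set of edges meets `δ(S)` in an odd number of edges if and only if `S` contains an odd number
of its odd nodes. -/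
lemma sum_cut_eq (J : Edge n → ZMod 2) (S : Finset (Fin n)) :
    ∑ e ∈ cut S, J e = ∑ v ∈ S, boundary J v := by
  have h1 : ∀ A : Finset (Edge n), ∑ e ∈ A, J e = ∑ e, (if e ∈ A then 1 else 0) * J e := by
    intro A; simp
  simp only [boundary_apply, h1]
  rw [Finset.sum_comm]
  refine Finset.sum_congr rfl fun e _ => ?_
  rw [cut_indicator, Finset.sum_mul]

lemma add_self_zmod_two {α : Type*} (f : α → ZMod 2) : f + f = 0 := by
  funext i
  exact CharTwo.add_self_eq_zero _

lemma eq_one_of_ne_zero {a : ZMod 2} (h : a ≠ 0) : a = 1 := by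
  revert a; decide

/-- If a set `D` of edges has `a ∉ S` as its only odd node outside `S`, it contains a path from `a`
to a node of `S` that has just one edge in `δ(S)`. Only the parity of the degrees in that path
matters. -/
lemma exists_path (S : Finset (Fin n)) (D : Edge n → ZMod 2) (a : Fin n) (ha : a ∉ S)
    (hD : ∀ v ∉ S, boundary D v = (Pi.single a 1 : Fin n → ZMod 2) v) :
    ∃ t ∈ S, ∃ P : Edge n → ZMod 2, (∀ e, P e ≠ 0 → D e ≠ 0) ∧
      boundary P = Pi.single a 1 + Pi.single t 1 ∧ ∑ e ∈ cut S, (P e).val = 1 := by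
  induction hk : (Finset.univ.filter fun e => D e ≠ 0).card using Nat.strong_induction_on
    generalizing D a with
  | _ k ih =>
  have hDa : boundary D a ≠ 0 := by rw [hD a ha]; simp
  rw [boundary_apply] at hDa
  obtain ⟨e, he, hDe⟩ := Finset.exists_ne_zero_of_sum_ne_zero hDa
  obtain ⟨s, u, h, hs, hu, rfl⟩ := exists_mk_of_mem_cut he
  obtain rfl : s = a := by simpa using hs
  have hsu : u ≠ s := by simpa using hu
  by_cases huS : u ∈ S
  · refine ⟨u, huS, Pi.single _ 1, ?_, boundary_single h, ?_⟩
    · intro e he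
      by_cases hee : e = ⟨s(s, u), h⟩
      · rwa [hee]
      · simp [hee] at he
    · rw [Finset.sum_eq_single (⟨s(s, u), h⟩ : Edge n)]
      · simp [ZMod.val_one]
      · intro b _ hb
        simp [hb]
      · intro hn
        exact absurd ((mk_mem_cut h S).2 (Or.inr ⟨huS, ha⟩)) hn
  · have hsub : ∀ e, (D + Pi.single (⟨s(s, u), h⟩ : Edge n) 1 : Edge n → ZMod 2) e ≠ 0 →
        D e ≠ 0 ∧ e ≠ ⟨s(s, u), h⟩ := by
      intro e he
      by_cases hee : e = ⟨s(s, u), h⟩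
      · subst hee
        simp [eq_one_of_ne_zero hDe, CharTwo.add_self_eq_zero] at he
      · simpa [Pi.single_apply, hee] using he
    have hlt : (Finset.univ.filter fun e =>
        (D + Pi.single (⟨s(s, u), h⟩ : Edge n) 1 : Edge n → ZMod 2) e ≠ 0).card < k := by
      rw [← hk]
      refine Finset.card_lt_card ((Finset.ssubset_iff_of_subset ?_).2 ⟨⟨s(s, u), h⟩, ?_, ?_⟩)
      · intro e he
        simp only [Finset.mem_filter, Finset.mem_univ, true_and] at he ⊢
        exact (hsub e he).1
      · simpa using hDe
      · intro he
        exact (hsub _ (Finset.mem_filter.1 he).2).2 rfl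
    have hb : ∀ v ∉ S, boundary (D + Pi.single (⟨s(s, u), h⟩ : Edge n) 1) v =
        (Pi.single u 1 : Fin n → ZMod 2) v := by
      intro v hv
      rw [map_add, boundary_single, Pi.add_apply, hD v hv, ← Pi.add_apply, ← add_assoc,
        add_self_zmod_two, zero_add]
    obtain ⟨t, ht, P, hP, hPb, hPc⟩ := ih _ hlt _ u huS hb rfl
    refine ⟨t, ht, P + Pi.single ⟨s(s, u), h⟩ 1, ?_, ?_, ?_⟩
    · intro e he
      by_cases hee : e = ⟨s(s, u), h⟩
      · rwa [hee]
      · exact (hsub e (hP e (by simpa [Pi.single_apply, hee] using he))).1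
    · rw [map_add, hPb, boundary_single]
      have := add_self_zmod_two (Pi.single u 1 : Fin n → ZMod 2)
      linear_combination this
    · rw [← hPc]
      refine Finset.sum_congr rfl fun e he => ?_
      have : e ≠ ⟨s(s, u), h⟩ := by
        rintro rfl
        rw [mk_mem_cut] at he
        tauto
      simp [this]

/-! ### Costs of edge sets -/

/-- The cost of a set of edges, given by its indicator modulo two. -/
def cost (c : Edge n → ℕ) (J : Edge n → ZMod 2) : ℕ := ∑ e, c e * (J e).val

lemma cost_add_le (c : Edge n → ℕ) (J K : Edge n → ZMod 2) :
    cost c (J + K) ≤ cost c J + cost c K := by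
  have key : ∀ a b : ZMod 2, (a + b).val ≤ a.val + b.val := by decide
  rw [cost, cost, cost, ← Finset.sum_add_distrib]
  refine Finset.sum_le_sum fun e _ => ?_
  rw [← mul_add]
  exact Nat.mul_le_mul_left _ (key _ _)

/-- Exchanging a part `P` of the symmetric difference of `J` and `K` preserves the total cost. -/
lemma cost_exchange (c : Edge n → ℕ) (J K P : Edge n → ZMod 2)
    (h : ∀ e, P e ≠ 0 → (J + K) e ≠ 0) :
    cost c (J + P) + cost c (K + P) = cost c J + cost c K := by
  have key : ∀ j k p : ZMod 2, (p ≠ 0 → j + k ≠ 0) →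
      (j + p).val + (k + p).val = j.val + k.val := by decide
  simp only [cost, ← Finset.sum_add_distrib, ← mul_add]
  exact Finset.sum_congr rfl fun e _ => congrArg _ (key _ _ _ (h e))

/-- Removing an edge of `J`, by adding it modulo two, lowers the cost by the cost of this edge. -/
lemma cost_add_single (c : Edge n → ℕ) (J : Edge n → ZMod 2) (e : Edge n) (he : J e ≠ 0) :
    cost c (J + Pi.single e 1) + c e = cost c J := by
  rw [cost, cost, ← Finset.add_sum_erase _ _ (Finset.mem_univ e),
    ← Finset.add_sum_erase (a := e) _ (fun e => c e * (J e).val) (Finset.mem_univ e)]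
  have h1 : ∀ f ∈ Finset.univ.erase e,
      c f * ((J + Pi.single e 1 : Edge n → ZMod 2) f).val = c f * (J f).val := by
    intro f hf
    simp [Finset.ne_of_mem_erase hf]
  rw [Finset.sum_congr rfl h1]
  have h2 : J e = 1 := eq_one_of_ne_zero he
  have h3 : (J + Pi.single e 1 : Edge n → ZMod 2) e = 0 := by
    simp [h2, CharTwo.add_self_eq_zero]
  rw [h2, h3, ZMod.val_zero, ZMod.val_one]
  ring

lemma cost_eq_zero_iff (c : Edge n → ℕ) (J : Edge n → ZMod 2) :
    cost c J = 0 ↔ ∀ e, J e ≠ 0 → c e = 0 := by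
  simp only [cost, Finset.sum_eq_zero_iff, Finset.mem_univ, true_imp_iff, mul_eq_zero,
    ZMod.val_eq_zero]
  exact forall_congr' fun e => by tauto

/-- The costs `c` have the parity of a potential `p` if `c_{uv} ≡ p_u + p_v` modulo two for all
edges `uv`, that is, if every circuit has an even cost. -/
def HasParity (c : Edge n → ℕ) (p : Fin n → ZMod 2) : Prop :=
  ∀ e, (c e : ZMod 2) = ∑ v, if e ∈ cut {v} then p v else 0

lemma HasParity.cost_cast {c : Edge n → ℕ} {p : Fin n → ZMod 2} (h : HasParity c p)
    (J : Edge n → ZMod 2) : (cost c J : ZMod 2) = ∑ v, p v * boundary J v := by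
  have h1 : ∀ v, p v * boundary J v = ∑ e, (if e ∈ cut {v} then p v else 0) * J e := by
    intro v
    rw [boundary_apply, Finset.mul_sum]
    simp
  simp only [h1, cost, Nat.cast_sum, Nat.cast_mul, ZMod.natCast_val, ZMod.cast_id', id]
  rw [Finset.sum_comm]
  refine Finset.sum_congr rfl fun e _ => ?_
  rw [h e, Finset.sum_mul]

/-- The costs after lowering the cost of every edge of the cut `δ(S)` by one. The subtraction
is truncated; the lemmas below assume that these edges have positive costs. -/
def reduceCost (c : Edge n → ℕ) (S : Finset (Fin n)) : Edge n → ℕ :=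
  fun e => c e - if e ∈ cut S then 1 else 0

section reduceCost

variable {c : Edge n → ℕ} {S : Finset (Fin n)}

lemma reduceCost_add (hS : ∀ e ∈ cut S, c e ≠ 0) (e : Edge n) :
    reduceCost c S e + (if e ∈ cut S then 1 else 0) = c e := by
  have := hS e
  unfold reduceCost
  split_ifs with h
  · have := this h
    omega
  · omega

lemma cost_reduceCost (hS : ∀ e ∈ cut S, c e ≠ 0) (J : Edge n → ZMod 2) :
    cost (reduceCost c S) J + ∑ e ∈ cut S, (J e).val = cost c J := by
  have h1 : ∑ e ∈ cut S, (J e).val = ∑ e, (if e ∈ cut S then 1 else 0) * (J e).val := by simp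
  rw [h1, cost, cost, ← Finset.sum_add_distrib]
  exact Finset.sum_congr rfl fun e _ => by rw [← add_mul, reduceCost_add hS]

lemma HasParity.reduceCost (hS : ∀ e ∈ cut S, c e ≠ 0) {p : Fin n → ZMod 2}
    (h : HasParity c p) :
    HasParity (reduceCost c S) (p + fun v => if v ∈ S then 1 else 0) := by
  intro e
  have h1 : ∀ v, (if e ∈ cut {v} then
        (p + fun v => if v ∈ S then 1 else 0 : Fin n → ZMod 2) v else 0)
      = (if e ∈ cut {v} then p v else 0) +
        if v ∈ S then (if e ∈ cut {v} then 1 else 0) else 0 := by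
    intro v
    by_cases h1 : e ∈ cut {v} <;> by_cases h2 : v ∈ S <;> simp [h1, h2]
  have h2 := congrArg (Nat.cast : ℕ → ZMod 2) (reduceCost_add hS e)
  push_cast at h2
  rw [Finset.sum_congr rfl fun v _ => h1 v, Finset.sum_add_distrib, ← h e, ← h2,
    Finset.sum_ite_mem, Finset.univ_inter, ← cut_indicator, add_assoc, CharTwo.add_self_eq_zero,
    add_zero]

end reduceCost

/-! ### Cuts of nodes joined at cost zero -/

/-- The nodes `v` that a `{t, v}`-join of cost zero joins to `t`. For `v = t`, this is a set with no
odd nodes, such as the empty one. -/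
noncomputable def zeroClass (c : Edge n → ℕ) (t : Fin n) : Finset (Fin n) := by
  classical
  exact Finset.univ.filter fun v => ∃ N, boundary N = Pi.single t 1 + Pi.single v 1 ∧ cost c N = 0

lemma mem_zeroClass {c : Edge n → ℕ} {t v : Fin n} : v ∈ zeroClass c t ↔
    ∃ N, boundary N = Pi.single t 1 + Pi.single v 1 ∧ cost c N = 0 := by
  simp [zeroClass]

lemma self_mem_zeroClass (c : Edge n → ℕ) (t : Fin n) : t ∈ zeroClass c t :=
  mem_zeroClass.2 ⟨0, by rw [map_zero, add_self_zmod_two], by simp [cost]⟩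

lemma ne_zero_of_mem_cut_zeroClass {c : Edge n → ℕ} {t : Fin n} (e : Edge n)
    (he : e ∈ cut (zeroClass c t)) : c e ≠ 0 := by
  obtain ⟨s, u, h, hs, hu, rfl⟩ := exists_mk_of_mem_cut he
  intro h0
  obtain ⟨N, hN, hN0⟩ := mem_zeroClass.1 hs
  refine hu (mem_zeroClass.2 ⟨N + Pi.single ⟨s(s, u), h⟩ 1, ?_, ?_⟩)
  · rw [map_add, hN, boundary_single]
    linear_combination add_self_zmod_two (Pi.single s 1 : Fin n → ZMod 2)
  · have := cost_add_le c N (Pi.single ⟨s(s, u), h⟩ 1)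
    have h1 : cost c (Pi.single (⟨s(s, u), h⟩ : Edge n) 1) = 0 := by
      rw [cost_eq_zero_iff]
      intro e he
      by_cases hee : e = ⟨s(s, u), h⟩
      · rwa [hee]
      · simp [hee] at he
    omega

/-- Every even set of nodes of a zero class is the set of odd nodes of some edge set of cost
zero. -/
lemma exists_cost_zero (c : Edge n → ℕ) (t : Fin n) (g : Fin n → ZMod 2)
    (hg : ∀ v ∉ zeroClass c t, g v = 0) (hsum : ∑ v, g v = 0) :
    ∃ N, boundary N = g ∧ cost c N = 0 := by
  have h : ∀ v, ∃ N, (v ∈ zeroClass c t → boundary N = Pi.single t 1 + Pi.single v 1) ∧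
      cost c N = 0 := by
    intro v
    by_cases hv : v ∈ zeroClass c t
    · obtain ⟨N, h1, h2⟩ := mem_zeroClass.1 hv
      exact ⟨N, fun _ => h1, h2⟩
    · exact ⟨0, fun h => absurd h hv, by simp [cost]⟩
  choose N hN hN0 using h
  refine ⟨∑ v, g v • N v, ?_, ?_⟩
  · have h1 : ∀ v, g v • boundary (N v) =
        g v • (Pi.single t 1 : Fin n → ZMod 2) + Pi.single v (g v) := by
      intro v
      by_cases hv : v ∈ zeroClass c t
      · rw [hN v hv, smul_add, ← Pi.single_smul' v (g v) (1 : ZMod 2), smul_eq_mul, mul_one]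
      · simp [hg v hv]
    rw [map_sum]
    simp only [map_smul]
    rw [Finset.sum_congr rfl fun v _ => h1 v, Finset.sum_add_distrib, ← Finset.sum_smul, hsum,
      zero_smul, zero_add, Finset.univ_sum_single]
  · rw [cost_eq_zero_iff]
    intro e he
    rw [Finset.sum_apply] at he
    obtain ⟨v, _, hv⟩ := Finset.exists_ne_zero_of_sum_ne_zero he
    refine (cost_eq_zero_iff c (N v)).1 (hN0 v) e fun h0 => hv ?_
    rw [Pi.smul_apply, h0, smul_zero]

/-- Let `K` have the smallest cost among all `(T Δ {a, b})`-joins, for all `a` and `b`, where the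
smallest cost of a `T`-join is positive. Then every cheapest `T`-join has just one edge in the cut
of the zero class of `b`. -/
lemma sum_cut_zeroClass_eq_one (c : Edge n → ℕ) (T : Fin n → ZMod 2) (a b : Fin n)
    (K : Edge n → ZMod 2) (hK : boundary K = T + Pi.single a 1 + Pi.single b 1)
    (hKmin : ∀ a' b' K', boundary K' = T + Pi.single a' 1 + Pi.single b' 1 → cost c K ≤ cost c K')
    (J : Edge n → ZMod 2) (hJ : boundary J = T)
    (hJmin : ∀ J', boundary J' = T → cost c J ≤ cost c J') (hpos : cost c J ≠ 0) :
    ∑ e ∈ cut (zeroClass c b), (J e).val = 1 := by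
  have hs := fun v => add_self_zmod_two (Pi.single v 1 : Fin n → ZMod 2)
  -- Otherwise `K` costs at least as much as `J`, and `J` minus an edge of positive cost costs less.
  have haS : a ∉ zeroClass c b := by
    intro ha
    obtain ⟨N, hN, hN0⟩ := mem_zeroClass.1 ha
    have h1 := hJmin (K + N) (by
      rw [map_add, hK, hN]; linear_combination hs a + hs b)
    have h2 := cost_add_le c K N
    rw [Ne, cost_eq_zero_iff] at hpos
    push Not at hpos
    obtain ⟨e, he, hce⟩ := hpos
    obtain ⟨u, v, huv, rfl⟩ := exists_mk e
    have h3 := hKmin u v (J + Pi.single ⟨s(u, v), by simpa using huv⟩ 1) (by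
      rw [map_add, hJ, boundary_single, add_assoc])
    have h4 := cost_add_single c J _ he
    omega
  obtain ⟨t, ht, P, hP, hPb, hPc⟩ := exists_path (zeroClass c b) (J + K) a haS (by
    intro v hv
    have hvb : v ≠ b := by
      rintro rfl
      exact hv (self_mem_zeroClass c v)
    have h1 := congrFun (add_self_zmod_two T) v
    rw [map_add, hJ, hK]
    simp only [Pi.add_apply, Pi.single_eq_of_ne hvb, Pi.zero_apply] at h1 ⊢
    linear_combination h1)
  obtain ⟨N, hN, hN0⟩ := mem_zeroClass.1 ht
  have h1 := cost_exchange c J K P hP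
  have h2 := cost_add_le c (K + P) N
  have h3 := hJmin (K + P + N) (by
    rw [map_add, map_add, hK, hPb, hN]; linear_combination hs a + hs b + hs t)
  rw [← hPc]
  refine Finset.sum_congr rfl fun e he => ?_
  -- Otherwise dropping `e` from `J + P`, which is as cheap as `K`, contradicts the choice of `K`.
  have h0 : (J + P) e = 0 := by
    by_contra hne
    have hce := ne_zero_of_mem_cut_zeroClass e he
    obtain ⟨s, u, h, hs', hu, rfl⟩ := exists_mk_of_mem_cut he
    obtain ⟨M, hM, hM0⟩ := mem_zeroClass.1 hs'
    have h4 := cost_add_single c (J + P) _ hne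
    have h5 := cost_add_le c (J + P + Pi.single ⟨s(s, u), h⟩ 1) N
    have h6 := cost_add_le c (J + P + Pi.single ⟨s(s, u), h⟩ 1 + N) M
    have h7 := hKmin a u (J + P + Pi.single ⟨s(s, u), h⟩ 1 + N + M) (by
      simp only [map_add, hJ, hPb, hN, hM, boundary_single]
      linear_combination hs b + hs t + hs s)
    omega
  rw [CharTwo.add_eq_zero.1 h0]

/-- In the situation of `sum_cut_zeroClass_eq_one`, and for costs that make every circuit even,
lowering the costs on the cut of the zero class by one lowers the smallest cost of a `T`-join by at
most one. This even holds for edge sets whose odd nodes agree with `T` outside the zero class. -/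
lemma cost_le_cost_reduceCost_add_one (c : Edge n → ℕ) (p : Fin n → ZMod 2) (hp : HasParity c p)
    (T : Fin n → ZMod 2) (b : Fin n) (J : Edge n → ZMod 2) (hJ : boundary J = T)
    (hJmin : ∀ J', boundary J' = T → cost c J ≤ cost c J')
    (hcut : ∀ J', boundary J' = T → cost c J' ≤ cost c J →
      ∑ e ∈ cut (zeroClass c b), (J' e).val = 1)
    (J' : Edge n → ZMod 2) (hJ' : ∀ v ∉ zeroClass c b, boundary J' v = T v) :
    cost c J ≤ cost (reduceCost c (zeroClass c b)) J' + 1 := by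
  have hS : ∀ e ∈ cut (zeroClass c b), c e ≠ 0 := ne_zero_of_mem_cut_zeroClass
  generalize hSdef : zeroClass c b = S at *
  have hT0 : ∀ L : Edge n → ZMod 2, ∑ v, boundary L v = 0 := by
    intro L
    rw [← sum_cut_eq]
    refine Finset.sum_eq_zero fun e he => ?_
    simp [cut] at he
  -- By parity, an edge set with at most three edges in the cut cannot be too cheap.
  have small : ∀ L : Edge n → ZMod 2, (∀ v ∉ S, boundary L v = T v) →
      ∑ e ∈ cut S, (L e).val ≤ 3 → cost c J ≤ cost (reduceCost c S) L + 1 := by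
    intro L hL hL3
    by_contra! hlt
    obtain ⟨N, hN, hN0⟩ := exists_cost_zero c b (boundary L + T) (by
      intro v hv
      rw [hSdef] at hv
      rw [Pi.add_apply, hL v hv, CharTwo.add_self_eq_zero]) (by
      simp only [Pi.add_apply, Finset.sum_add_distrib]
      rw [hT0, ← hJ, hT0, add_zero])
    have hLN : boundary (L + N) = T := by
      rw [map_add, hN]
      linear_combination add_self_zmod_two (boundary L)
    have h1 := cost_reduceCost hS L
    have h2 := cost_add_le c L N
    have h3 : (cost c (L + N) : ZMod 2) = cost c J := by
      rw [hp.cost_cast, hp.cost_cast, hLN, hJ]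
    rw [ZMod.natCast_eq_natCast_iff'] at h3
    have h4 := hcut (L + N) hLN (by omega)
    have h5 : ∑ e ∈ cut S, (L e).val = ∑ e ∈ cut S, ((L + N) e).val := by
      refine Finset.sum_congr rfl fun e he => ?_
      have : N e = 0 := by
        by_contra hne
        exact hS e he ((cost_eq_zero_iff c N).1 hN0 e hne)
      rw [Pi.add_apply, this, add_zero]
    have h6 := hJmin (L + N) hLN
    omega
  have hJcut := hcut J hJ le_rfl
  have hJr := cost_reduceCost hS J
  induction hk : (Finset.univ.filter fun e => (J + J') e ≠ 0).card using Nat.strong_induction_on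
    generalizing J' with
  | _ k ih =>
  by_cases hD : ∀ e ∈ cut S, (J + J') e = 0
  · refine small J' hJ' ?_
    have : ∑ e ∈ cut S, (J' e).val = ∑ e ∈ cut S, (J e).val :=
      Finset.sum_congr rfl fun e he => by rw [CharTwo.add_eq_zero.1 (hD e he)]
    omega
  -- Otherwise exchange a circuit of the symmetric difference that crosses the cut twice.
  push Not at hD
  obtain ⟨e, he, hDe⟩ := hD
  have heS := he
  obtain ⟨s, u, h, hs, hu, rfl⟩ := exists_mk_of_mem_cut he
  obtain ⟨t, ht, P, hP, hPb, hPc⟩ := exists_path S (J + J' + Pi.single ⟨s(s, u), h⟩ 1) u hu (by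
    intro v hv
    have hvs : v ≠ s := by
      rintro rfl
      exact hv hs
    simp only [map_add, boundary_single, Pi.add_apply, hJ, hJ' v hv, Pi.single_eq_of_ne hvs]
    rw [CharTwo.add_self_eq_zero, zero_add, zero_add])
  have hPe : P ⟨s(s, u), h⟩ = 0 := by
    by_contra hne
    refine hP _ hne ?_
    rw [Pi.add_apply, eq_one_of_ne_zero hDe, Pi.single_eq_same, CharTwo.add_self_eq_zero]
  obtain ⟨C, hCdef⟩ : ∃ C, C = P + Pi.single (⟨s(s, u), h⟩ : Edge n) 1 := ⟨_, rfl⟩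
  have hCe : C ⟨s(s, u), h⟩ = 1 := by simp [hCdef, hPe]
  have hC : ∀ f, C f ≠ 0 → (J + J') f ≠ 0 := by
    intro f hf
    by_cases hfe : f = ⟨s(s, u), h⟩
    · rwa [hfe]
    · have := hP f (by simpa [hCdef, hfe] using hf)
      simpa [hfe] using this
  have hCb : ∀ v ∉ S, boundary C v = 0 := by
    intro v hv
    have hvs : v ≠ s := by
      rintro rfl
      exact hv hs
    have hvt : v ≠ t := by
      rintro rfl
      exact hv ht
    rw [hCdef, map_add, hPb, boundary_single]
    simp only [Pi.add_apply, Pi.single_eq_of_ne hvs, Pi.single_eq_of_ne hvt, add_zero, zero_add]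
    exact CharTwo.add_self_eq_zero _
  have hcost_single : ∑ f ∈ cut S, ((Pi.single (⟨s(s, u), h⟩ : Edge n) 1 : Edge n → ZMod 2) f).val
      ≤ 1 := by
    rw [Finset.sum_eq_single_of_mem _ heS]
    · simp [ZMod.val_one]
    · intro f _ hf
      simp [hf]
  have hval : ∀ a b : ZMod 2, (a + b).val ≤ a.val + b.val := by decide
  have hCcut : ∑ f ∈ cut S, ((J + C) f).val ≤ 3 := by
    calc ∑ f ∈ cut S, ((J + C) f).val
        ≤ ∑ f ∈ cut S, ((J f).val + ((P f).val +
          ((Pi.single (⟨s(s, u), h⟩ : Edge n) 1 : Edge n → ZMod 2) f).val)) := by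
          refine Finset.sum_le_sum fun f _ => ?_
          rw [hCdef]
          exact (hval _ _).trans (Nat.add_le_add_left (hval _ _) _)
      _ ≤ 3 := by
          rw [Finset.sum_add_distrib, Finset.sum_add_distrib]
          omega
  have h1 := small (J + C) (by
    intro v hv
    rw [map_add, Pi.add_apply, hJ, hCb v hv, add_zero]) hCcut
  have h2 := cost_exchange (reduceCost c S) J J' C hC
  have h3 := ih _ ?_ (J' + C) (by
    intro v hv
    rw [map_add, Pi.add_apply, hJ' v hv, hCb v hv, add_zero]) rfl
  · omega
  · rw [← hk]
    refine Finset.card_lt_card ((Finset.ssubset_iff_of_subset ?_).2 ⟨⟨s(s, u), h⟩, ?_, ?_⟩)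
    · intro f hf
      simp only [Finset.mem_filter, Finset.mem_univ, true_and] at hf ⊢
      intro h0
      refine hf ?_
      have hCf : C f = 0 := by
        by_contra hne
        exact hC f hne h0
      rw [← add_assoc, Pi.add_apply, h0, hCf, add_zero]
    · simpa using hDe
    · rw [Finset.mem_filter, ← add_assoc, Pi.add_apply, hCe, eq_one_of_ne_zero hDe]
      simp [CharTwo.add_self_eq_zero]

/-! ### The `T`-join polyhedron -/

/-- The `T`-join theorem for integral costs that make every circuit even: the cost of a cheapest
`T`-join is at most the cost of any fractional vector `y` that covers all `T`-cuts. -/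
theorem exists_join_cost_le (T : Fin n → ZMod 2) (hT : ∃ J, boundary J = T) (y : Edge n → ℝ)
    (hy0 : ∀ e, 0 ≤ y e)
    (hy : ∀ S : Finset (Fin n), ∑ v ∈ S, T v = 1 → 1 ≤ ∑ e ∈ cut S, y e)
    (c : Edge n → ℕ) (p : Fin n → ZMod 2) (hp : HasParity c p) :
    ∃ J, boundary J = T ∧ (cost c J : ℝ) ≤ ∑ e, c e * y e := by
  induction hk : ∑ e, c e using Nat.strong_induction_on generalizing c p with
  | _ k ih =>
  classical
  obtain ⟨J₁, hJ₁⟩ := hT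
  obtain ⟨J, hJmem, hJmin⟩ := Finset.exists_min_image
    (Finset.univ.filter fun J : Edge n → ZMod 2 => boundary J = T) (cost c) ⟨J₁, by simpa using hJ₁⟩
  simp only [Finset.mem_filter, Finset.mem_univ, true_and] at hJmem hJmin
  by_cases hpos : cost c J = 0
  · refine ⟨J, hJmem, ?_⟩
    rw [hpos, Nat.cast_zero]
    exact Finset.sum_nonneg fun e _ => mul_nonneg (Nat.cast_nonneg _) (hy0 e)
  have hne : ∃ v₀ : Fin n, True := by
    rw [cost_eq_zero_iff] at hpos
    push Not at hpos
    obtain ⟨e, -⟩ := hpos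
    obtain ⟨u, -⟩ := exists_mk e
    exact ⟨u, trivial⟩
  obtain ⟨v₀, -⟩ := hne
  obtain ⟨⟨a, b, K⟩, hK, hKmin⟩ := Finset.exists_min_image
    (Finset.univ.filter fun q : Fin n × Fin n × (Edge n → ZMod 2) =>
      boundary q.2.2 = T + Pi.single q.1 1 + Pi.single q.2.1 1) (fun q => cost c q.2.2)
    ⟨(v₀, v₀, J), by simp [hJmem, add_assoc, add_self_zmod_two]⟩
  simp only [Finset.mem_filter, Finset.mem_univ, true_and, Prod.forall] at hK hKmin
  have hcut : ∀ J', boundary J' = T → cost c J' ≤ cost c J →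
      ∑ e ∈ cut (zeroClass c b), (J' e).val = 1 := fun J' hJ' hle =>
    sum_cut_zeroClass_eq_one c T a b K hK hKmin J' hJ'
      (fun L hL => hle.trans (hJmin L hL)) (fun h0 => hpos (by have := hJmin J' hJ'; omega))
  have hS : ∀ e ∈ cut (zeroClass c b), c e ≠ 0 := ne_zero_of_mem_cut_zeroClass
  have hJcut := hcut J hJmem le_rfl
  have hodd : ∑ v ∈ zeroClass c b, T v = 1 := by
    rw [← hJmem, ← sum_cut_eq]
    have := congrArg (Nat.cast : ℕ → ZMod 2) hJcut
    simpa using this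
  have hlt : ∑ e, reduceCost c (zeroClass c b) e < k := by
    rw [← hk]
    obtain ⟨e, he, -⟩ := Finset.exists_ne_zero_of_sum_ne_zero (hJcut.trans_ne one_ne_zero)
    refine Finset.sum_lt_sum (fun e _ => Nat.sub_le _ _) ⟨e, Finset.mem_univ e, ?_⟩
    have := reduceCost_add hS e
    rw [if_pos he] at this
    omega
  obtain ⟨J', hJ', hle⟩ := ih _ hlt (reduceCost c (zeroClass c b)) _ (hp.reduceCost hS) rfl
  refine ⟨J, hJmem, ?_⟩
  have h1 := cost_le_cost_reduceCost_add_one c p hp T b J hJmem hJmin hcut J' fun v _ => by rw [hJ']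
  have h2 : ∑ e, (c e : ℝ) * y e = ∑ e, (reduceCost c (zeroClass c b) e : ℝ) * y e +
      ∑ e ∈ cut (zeroClass c b), y e := by
    have h3 : ∑ e ∈ cut (zeroClass c b), y e =
        ∑ e, (if e ∈ cut (zeroClass c b) then 1 else 0) * y e := by simp
    rw [h3, ← Finset.sum_add_distrib]
    refine Finset.sum_congr rfl fun e _ => ?_
    rw [← reduceCost_add hS e, ← add_mul]
    push_cast
    rfl
  have h4 := hy _ hodd
  have h5 : (cost c J : ℝ) ≤ cost (reduceCost c (zeroClass c b)) J' + 1 := by exact_mod_cast h1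
  linarith

/-- The claim of `exists_join_cost_le` for arbitrary nonnegative real costs, by rounding large
multiples of the costs up to even integers. -/
lemma exists_join_real_cost_le (T : Fin n → ZMod 2) (hT : ∃ J, boundary J = T) (y : Edge n → ℝ)
    (hy0 : ∀ e, 0 ≤ y e)
    (hy : ∀ S : Finset (Fin n), ∑ v ∈ S, T v = 1 → 1 ≤ ∑ e ∈ cut S, y e)
    (c : Edge n → ℝ) (hc : ∀ e, 0 ≤ c e) :
    ∃ J, boundary J = T ∧ ∑ e, c e * ((J e).val : ℝ) ≤ ∑ e, c e * y e := by
  classical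
  obtain ⟨J₁, hJ₁⟩ := hT
  obtain ⟨J, hJ, hJmin⟩ := Finset.exists_min_image
    (Finset.univ.filter fun J : Edge n → ZMod 2 => boundary J = T)
    (fun J => ∑ e, c e * ((J e).val : ℝ)) ⟨J₁, by simpa using hJ₁⟩
  simp only [Finset.mem_filter, Finset.mem_univ, true_and] at hJ hJmin
  refine ⟨J, hJ, ?_⟩
  by_contra! hlt
  -- After division by `2 * N`, the rounding error is at most `(∑ e, y e) / N`.
  obtain ⟨N, hN⟩ := exists_nat_gt
    ((∑ e, y e) / (∑ e, c e * ((J e).val : ℝ) - ∑ e, c e * y e))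
  rw [div_lt_iff₀ (sub_pos.2 hlt)] at hN
  obtain ⟨L, hL, hLle⟩ := exists_join_cost_le T ⟨J, hJ⟩ y hy0 hy
    (fun e => 2 * ⌈(N : ℝ) * c e⌉₊) 0 (fun e => by
      have h2 : (2 : ZMod 2) = 0 := rfl
      simp [h2])
  have h1 : (2 * N : ℝ) * ∑ e, c e * ((L e).val : ℝ) ≤
      (cost (fun e => 2 * ⌈(N : ℝ) * c e⌉₊) L : ℝ) := by
    simp only [cost, Nat.cast_sum, Nat.cast_mul, Nat.cast_ofNat, Finset.mul_sum]
    refine Finset.sum_le_sum fun e _ => ?_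
    have := mul_le_mul_of_nonneg_right (Nat.le_ceil ((N : ℝ) * c e))
      (Nat.cast_nonneg (α := ℝ) (L e).val)
    linarith
  have h2 : ∑ e, ((2 * ⌈(N : ℝ) * c e⌉₊ : ℕ) : ℝ) * y e ≤
      (2 * N : ℝ) * ∑ e, c e * y e + 2 * ∑ e, y e := by
    rw [Finset.mul_sum, Finset.mul_sum, ← Finset.sum_add_distrib]
    refine Finset.sum_le_sum fun e _ => ?_
    have := mul_le_mul_of_nonneg_right
      (Nat.ceil_lt_add_one (mul_nonneg (Nat.cast_nonneg (α := ℝ) N) (hc e))).le (hy0 e)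
    push_cast
    linarith
  have h3 := mul_le_mul_of_nonneg_left (hJmin L hL) (Nat.cast_nonneg (α := ℝ) N)
  linarith

/-- The theorem of Edmonds and Johnson: a nonnegative vector that covers all `T`-cuts dominates a
convex combination of incidence vectors of `T`-joins. -/
theorem exists_mem_convexHull_join_le (T : Fin n → ZMod 2) (hT : ∃ J, boundary J = T)
    (y : Edge n → ℝ) (hy0 : ∀ e, 0 ≤ y e)
    (hy : ∀ S : Finset (Fin n), ∑ v ∈ S, T v = 1 → 1 ≤ ∑ e ∈ cut S, y e) :
    ∃ q ∈ convexHull ℝ {z : Edge n → ℝ | ∃ J, boundary J = T ∧ z = fun e => ((J e).val : ℝ)},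
      q ≤ y := by
  set s := {z : Edge n → ℝ | ∃ J, boundary J = T ∧ z = fun e => ((J e).val : ℝ)} with hs
  by_contra! hno
  have hfin : s.Finite := by
    refine (Set.finite_range fun (J : Edge n → ZMod 2) e => ((J e).val : ℝ)).subset ?_
    rintro z ⟨J, -, rfl⟩
    exact ⟨J, rfl⟩
  obtain ⟨f, u, v, hfu, huv, hfv⟩ := geometric_hahn_banach_compact_closed
    (convex_convexHull ℝ s) (hfin.isCompact_convexHull ℝ) (convex_Iic y) isClosed_Iic
    (Set.disjoint_left.2 fun q hq hqy => hno q hq hqy)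
  have hf : ∀ z : Edge n → ℝ, f z = ∑ e, z e * f (Pi.single e 1) := by
    intro z
    conv_lhs => rw [← Finset.univ_sum_single z, map_sum]
    refine Finset.sum_congr rfl fun e _ => ?_
    rw [← smul_eq_mul, ← map_smul, ← Pi.single_smul', smul_eq_mul, mul_one]
  -- `f` is bounded below on `y - ℝ₊`, so its coefficients are not positive.
  have hneg : ∀ e, f (Pi.single e 1) ≤ 0 := by
    intro e
    by_contra! hpos
    have h1 : (0 : ℝ) ≤ max 0 ((f y - v) / f (Pi.single e 1)) := le_max_left _ _
    have h2 := hfv (y - max 0 ((f y - v) / f (Pi.single e 1)) • Pi.single e 1) (by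
      rw [Set.mem_Iic, sub_le_self_iff]
      exact smul_nonneg h1 (Pi.single_nonneg.2 zero_le_one))
    rw [map_sub, map_smul, smul_eq_mul] at h2
    have h3 := (div_le_iff₀ hpos).1 (le_max_right 0 ((f y - v) / f (Pi.single e 1)))
    linarith
  obtain ⟨J, hJ, hle⟩ := exists_join_real_cost_le T hT y hy0 hy (fun e => -f (Pi.single e 1))
    fun e => neg_nonneg.2 (hneg e)
  have h1 := hfu (fun e => ((J e).val : ℝ)) (subset_convexHull ℝ s ⟨J, hJ, rfl⟩)
  have h2 := hfv y (Set.mem_Iic.2 le_rfl)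
  rw [hf] at h1 h2
  simp only [neg_mul, Finset.sum_neg_distrib, mul_comm (f _)] at hle
  linarith

/-! ### Tours and `1`-trees -/

lemma sum_setMultiplicity (F C : Finset (Edge n)) :
    ∑ e ∈ C, setMultiplicity F e = (F ∩ C).card := by
  simp only [setMultiplicity]
  rw [Finset.sum_ite_mem, Finset.sum_const, smul_eq_mul, mul_one, Finset.inter_comm]

lemma edgeGraph_adj {F : Set (Edge n)} {u v : Fin n} :
    (edgeGraph F).Adj u v ↔ ∃ h : ¬ s(u, v).IsDiag, (⟨s(u, v), h⟩ : Edge n) ∈ F := by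
  simp [edgeGraph, SimpleGraph.fromEdgeSet_adj]

lemma edgeGraph_mono {F G : Set (Edge n)} (h : F ⊆ G) : edgeGraph F ≤ edgeGraph G :=
  SimpleGraph.fromEdgeSet_mono (Set.image_mono h)

lemma setMultiplicity_support (F : Finset (Edge n)) :
    {e | 0 < setMultiplicity F e} = (F : Set (Edge n)) := by
  ext e
  simp [setMultiplicity, Nat.pos_iff_ne_zero]

lemma exists_mem_cut_of_connected {F : Finset (Edge n)}
    (hF : (edgeGraph (F : Set (Edge n))).Connected) {S : Finset (Fin n)} (hne : S.Nonempty)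
    (huniv : S ≠ Finset.univ) : (F ∩ cut S).Nonempty := by
  obtain ⟨u, hu⟩ := hne
  obtain ⟨v, hv⟩ : ∃ v, v ∉ S := by
    by_contra! h
    exact huniv (Finset.eq_univ_iff_forall.2 h)
  obtain ⟨w⟩ := hF.preconnected u v
  obtain ⟨d, -, hd1, hd2⟩ := w.exists_boundary_dart (S : Set (Fin n)) hu hv
  obtain ⟨h, hmem⟩ := edgeGraph_adj.1 d.adj
  exact ⟨_, Finset.mem_inter.2 ⟨hmem, (mk_mem_cut h S).2 (Or.inl ⟨hd1, hd2⟩)⟩⟩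

lemma IsOneTree.connected {r : Fin n} {F : Finset (Edge n)} (hF : IsOneTree r F) :
    (edgeGraph (F : Set (Edge n))).Connected := by
  obtain ⟨hcard, htree⟩ := hF
  obtain ⟨e, he⟩ : (F ∩ cut {r}).Nonempty := by
    rw [← Finset.card_pos, hcard]
    exact two_pos
  rw [Finset.mem_inter] at he
  obtain ⟨s, u, h, hs, hu, rfl⟩ := exists_mk_of_mem_cut he.2
  obtain rfl : s = r := by simpa using hs
  have hur : u ≠ s := by simpa using hu
  rw [SimpleGraph.connected_iff_exists_forall_reachable]
  refine ⟨u, fun v => ?_⟩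
  by_cases hv : v = s
  · subst hv
    exact (edgeGraph_adj.2 ⟨h, he.1⟩).reachable.symm
  · have h1 := htree.connected.preconnected ⟨u, hur⟩ ⟨v, hv⟩
    have h2 := h1.map (SimpleGraph.Embedding.induce {v | v ≠ s}).toHom
    exact h2.mono (edgeGraph_mono (by simp))

/-- An edge multiset of even degrees meets every cut in an even number of edges. -/
lemma even_sum_cut {J : Edge n → ℕ} (hJ : ∀ v, Even (∑ e ∈ cut {v}, J e)) (S : Finset (Fin n)) :
    Even (∑ e ∈ cut S, J e) := by
  rw [← ZMod.natCast_eq_zero_iff_even, Nat.cast_sum, sum_cut_eq]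
  refine Finset.sum_eq_zero fun v _ => ?_
  rw [boundary_apply, ← Nat.cast_sum, ZMod.natCast_eq_zero_iff_even]
  exact hJ v

lemma IsTour.add_even {J : Edge n → ℕ} (hJ : IsTour J) (e : Edge n) (k : ℕ) :
    IsTour (J + Pi.single e (2 * k)) := by
  refine ⟨hJ.1.mono (edgeGraph_mono fun f hf => ?_), fun v => ?_⟩
  · exact Nat.lt_of_lt_of_le hf (Nat.le_add_right _ _)
  · simp only [Pi.add_apply, Finset.sum_add_distrib]
    refine (hJ.2 v).add ?_
    refine Finset.even_sum _ fun f _ => ?_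
    by_cases hf : f = e
    · subst hf; simp
    · simp [hf]

lemma add_single_mem_tourPolyhedron {z : Edge n → ℝ} (hz : z ∈ tourPolyhedron n) (e : Edge n)
    {t : ℝ} (ht : 0 ≤ t) : z + Pi.single e t ∈ tourPolyhedron n := by
  have hconv : Convex ℝ ((fun z => z + (Pi.single e t : Edge n → ℝ)) ⁻¹' tourPolyhedron n) :=
    (convex_convexHull ℝ _).translate_preimage_left _
  refine convexHull_min ?_ hconv hz
  rintro _ ⟨J, hJ, rfl⟩
  obtain ⟨k, hk⟩ := exists_nat_gt t
  have hk0 : (0 : ℝ) < k := ht.trans_lt hk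
  have h1 : incidenceVector J ∈ tourPolyhedron n := subset_convexHull ℝ _ ⟨J, hJ, rfl⟩
  have h2 : incidenceVector (J + Pi.single e (2 * k)) ∈ tourPolyhedron n :=
    subset_convexHull ℝ _ ⟨_, hJ.add_even e k, rfl⟩
  have hle : t / (2 * k) ≤ 1 := by
    rw [div_le_one (by positivity)]
    linarith
  have hT : Convex ℝ (tourPolyhedron n) := convex_convexHull ℝ _
  have h3 := hT h1 h2 (sub_nonneg.2 hle) (by positivity) (sub_add_cancel _ _)
  rw [Set.mem_preimage]
  convert h3 using 1
  funext f
  by_cases hf : f = e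
  · subst hf
    simp only [incidenceVector, Pi.add_apply, Pi.smul_apply, Pi.single_eq_same, smul_eq_mul]
    push_cast
    field_simp
    ring
  · simp only [incidenceVector, Pi.add_apply, Pi.smul_apply, Pi.single_eq_of_ne hf, smul_eq_mul,
      Nat.add_zero]
    ring

/-- Edges may be doubled, so the polyhedron of tours is closed upwards. -/
lemma mem_tourPolyhedron_of_le {z w : Edge n → ℝ} (hz : z ∈ tourPolyhedron n) (hzw : z ≤ w) :
    w ∈ tourPolyhedron n := by
  have h : ∀ A : Finset (Edge n), z + ∑ e ∈ A, Pi.single e (w e - z e) ∈ tourPolyhedron n := by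
    classical
    intro A
    induction A using Finset.induction_on with
    | empty => simpa using hz
    | insert e A he ih =>
      rw [Finset.sum_insert he, add_comm (Pi.single e _), ← add_assoc]
      exact add_single_mem_tourPolyhedron ih e (sub_nonneg.2 (hzw e))
  have h1 := h Finset.univ
  rw [Finset.univ_sum_single (fun e => w e - z e)] at h1
  convert h1 using 1
  funext e
  simp

lemma IsHamiltonianCycle.isTour {E H : Finset (Edge n)} (hH : IsHamiltonianCycle E H) :
    IsTour (setMultiplicity H) := by
  refine ⟨?_, fun v => ?_⟩
  · rw [setMultiplicity_support]
    exact hH.2.1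
  · rw [sum_setMultiplicity, hH.2.2 v]
    exact even_two

/-- A nonnegative vector that covers every cut which the connected set `F` meets in an odd number of
edges pays for a join that corrects the parities of the degrees of `F`. -/
lemma add_mem_tourPolyhedron {F : Finset (Edge n)}
    (hF : (edgeGraph (F : Set (Edge n))).Connected) (y : Edge n → ℝ) (hy0 : ∀ e, 0 ≤ y e)
    (hy : ∀ S : Finset (Fin n), Odd (F ∩ cut S).card → 1 ≤ ∑ e ∈ cut S, y e) :
    incidenceVector (setMultiplicity F) + y ∈ tourPolyhedron n := by
  have hcast : ∀ C : Finset (Edge n),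
      ∑ e ∈ C, (setMultiplicity F e : ZMod 2) = ((F ∩ C).card : ZMod 2) := by
    intro C
    rw [← Nat.cast_sum, sum_setMultiplicity]
  obtain ⟨q, hq, hqy⟩ := exists_mem_convexHull_join_le
    (boundary fun e => (setMultiplicity F e : ZMod 2)) ⟨_, rfl⟩ y hy0 (by
      intro S hS
      rw [← sum_cut_eq, hcast, ZMod.natCast_eq_one_iff_odd] at hS
      exact hy S hS)
  refine mem_tourPolyhedron_of_le (z := incidenceVector (setMultiplicity F) + q) ?_
    (add_le_add_right hqy _)
  have hconv : Convex ℝ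
      ((fun z => incidenceVector (setMultiplicity F) + z) ⁻¹' tourPolyhedron n) :=
    (convex_convexHull ℝ _).translate_preimage_right _
  refine convexHull_min ?_ hconv hq
  rintro _ ⟨J, hJ, rfl⟩
  refine subset_convexHull ℝ _ ⟨fun e => setMultiplicity F e + (J e).val, ⟨?_, fun v => ?_⟩, ?_⟩
  · refine hF.mono (edgeGraph_mono ?_)
    rw [← setMultiplicity_support]
    exact fun e he => Nat.lt_of_lt_of_le he (Nat.le_add_right _ _)
  · have h1 := congrFun hJ v
    rw [boundary_apply, boundary_apply] at h1
    rw [← ZMod.natCast_eq_zero_iff_even]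
    push_cast
    rw [Finset.sum_add_distrib, ← h1]
    simp [CharTwo.add_self_eq_zero]
  · funext e
    simp [incidenceVector]

/-! ### The cut condition -/

/-- The vector `(4x - h) / 6`, with `h` the incidence vector of `H`, covers every cut that a
`1`-tree as in Property (B) meets in an odd number of edges. -/
lemma one_le_sum_cut {x : Edge n → ℝ} (hx : x ∈ subtourPolytope n) (hhalf : IsHalfInteger x)
    {H : Finset (Edge n)} (hH : PropertyA x H) {F : Finset (Edge n)} (hFx : F ⊆ supportEdges x)
    (hF : ∀ C : Finset (Edge n), IsFourHalfEdgeCut x H C → Even (F ∩ C).card)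
    (S : Finset (Fin n)) (hS : Odd (F ∩ cut S).card) :
    1 ≤ ∑ e ∈ cut S, (4 * x e - (setMultiplicity H e : ℝ)) / 6 := by
  obtain ⟨hdeg, hcut, -⟩ := hx
  have hm : ∀ e, ∃ k : ℕ, x e = k / 2 := by
    intro e
    rcases hhalf e with h | h | h
    · exact ⟨0, by rw [h]; norm_num⟩
    · exact ⟨1, by rw [h]; norm_num⟩
    · exact ⟨2, by rw [h]; norm_num⟩
  choose m hm using hm
  have hsum : ∀ C : Finset (Edge n), ∑ e ∈ C, x e = ((∑ e ∈ C, m e : ℕ) : ℝ) / 2 := by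
    intro C
    rw [Nat.cast_sum, Finset.sum_div]
    exact Finset.sum_congr rfl fun e _ => hm e
  have hmdeg : ∀ v, Even (∑ e ∈ cut {v}, m e) := by
    intro v
    have h1 := hdeg v
    rw [hsum, div_eq_iff two_ne_zero] at h1
    norm_num at h1
    have h2 : ∑ e ∈ cut {v}, m e = 4 := by exact_mod_cast h1
    rw [h2]
    decide
  obtain ⟨f, hf⟩ : (F ∩ cut S).Nonempty := Finset.card_pos.1 hS.pos
  obtain ⟨s, u, -, hs, hu, -⟩ := exists_mk_of_mem_cut (Finset.mem_inter.1 hf).2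
  have hne : S.Nonempty := ⟨s, hs⟩
  have huniv : S ≠ Finset.univ := by
    rintro rfl
    exact hu (Finset.mem_univ u)
  have hM4 : 4 ≤ ∑ e ∈ cut S, m e := by
    have h1 := hcut S hne huniv
    rw [hsum, le_div_iff₀ two_pos] at h1
    norm_num at h1
    exact_mod_cast h1
  have hMeven := even_sum_cut hmdeg S
  have hHeven := even_sum_cut hH.isTour.2 S
  have hHpos : 0 < ∑ e ∈ cut S, setMultiplicity H e := by
    rw [sum_setMultiplicity, Finset.card_pos]
    exact exists_mem_cut_of_connected hH.2.1 hne huniv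
  have hmH : ∀ e, setMultiplicity H e ≤ m e := by
    intro e
    by_cases he : e ∈ H
    · have h1 : 0 < x e := (Finset.mem_filter.1 (hH.1 he)).2
      rw [hm e] at h1
      have h2 : 0 < m e := by
        by_contra h0
        simp [Nat.eq_zero_of_not_pos h0] at h1
      simp only [setMultiplicity, he, if_true]
      exact h2
    · simp [setMultiplicity, he]
  have hle : ∑ e ∈ cut S, setMultiplicity H e ≤ ∑ e ∈ cut S, m e :=
    Finset.sum_le_sum fun e _ => hmH e
  have hkey : 6 + ∑ e ∈ cut S, setMultiplicity H e ≤ 2 * ∑ e ∈ cut S, m e := by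
    by_contra! hlt
    -- The cut consists of four ½-edges of `H`, which `F` meets in an even number of edges.
    have hM : ∑ e ∈ cut S, m e = 4 := by
      obtain ⟨i, hi⟩ := hMeven
      omega
    have hH4 : ∑ e ∈ cut S, setMultiplicity H e = 4 := by
      obtain ⟨i, hi⟩ := hHeven
      omega
    have heq : ∀ e ∈ cut S, setMultiplicity H e = m e :=
      (Finset.sum_eq_sum_iff_of_le fun e _ => hmH e).1 (hH4.trans hM.symm)
    have hC : supportEdges x ∩ cut S = H ∩ cut S := by
      ext e
      rw [Finset.mem_inter, Finset.mem_inter]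
      refine and_congr_left fun he => ⟨fun hex => ?_, fun h => hH.1 h⟩
      have h1 : 0 < x e := (Finset.mem_filter.1 hex).2
      rw [hm e, ← heq e he] at h1
      by_contra heH
      simp [setMultiplicity, heH] at h1
    have hFC := hF (supportEdges x ∩ cut S) ⟨⟨S, rfl⟩, by rw [hC, ← sum_setMultiplicity, hH4], by
      intro e he
      rw [hC, Finset.mem_inter] at he
      refine ⟨?_, he.1⟩
      rw [hm e, ← heq e he.2]
      simp [setMultiplicity, he.1]⟩
    rw [← Finset.inter_assoc, Finset.inter_eq_left.2 hFx] at hFC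
    exact Nat.not_even_iff_odd.2 hS hFC
  rw [← Finset.sum_div, Finset.sum_sub_distrib, ← Finset.mul_sum, hsum, ← Nat.cast_sum,
    le_div_iff₀ (by norm_num)]
  have h1 : (6 : ℝ) + (∑ e ∈ cut S, setMultiplicity H e : ℕ) ≤ 2 * (∑ e ∈ cut S, m e : ℕ) := by
    exact_mod_cast hkey
  linarith

end TSP

theorem theorem4 (n : ℕ) (r : Fin n) (x : TSP.Edge n → ℝ)
    (hx : x ∈ TSP.subtourPolytope n) (hhalf : TSP.IsHalfInteger x)
    (hAB : ∃ H : Finset (TSP.Edge n), TSP.PropertyA x H ∧ TSP.PropertyB r x H) :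
    (10 / 7 : ℝ) • x ∈ TSP.tourPolyhedron n := by
  classical
  obtain ⟨H, hA, hB⟩ := hAB
  have hT : Convex ℝ (TSP.tourPolyhedron n) := convex_convexHull ℝ _
  obtain ⟨y, hy⟩ : ∃ y : TSP.Edge n → ℝ,
    y = fun e => (4 * x e - (TSP.setMultiplicity H e : ℝ)) / 6 := ⟨_, rfl⟩
  have hy0 : ∀ e, 0 ≤ y e := by
    intro e
    rw [hy]
    by_cases he : e ∈ H
    · have h1 : 0 < x e := (Finset.mem_filter.1 (hA.1 he)).2
      have h2 : 1 / 2 ≤ x e := by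
        rcases hhalf e with h | h | h <;> linarith
      simp only [TSP.setMultiplicity, he, if_true, Nat.cast_one]
      linarith
    · have h1 := (hx.2.2 e).1
      simp only [TSP.setMultiplicity, he, if_false, Nat.cast_zero]
      linarith
  have hxy : x + y ∈ TSP.tourPolyhedron n := by
    rw [TSP.PropertyB, mem_convexHull_iff_exists_fintype] at hB
    obtain ⟨ι, _, w, z, hw0, hw1, hz, hwz⟩ := hB
    have hmem : ∀ i ∈ Finset.univ.filter (fun i => w i ≠ 0), z i + y ∈ TSP.tourPolyhedron n := by
      intro i hi
      obtain ⟨F, hF, hFC, hzF⟩ := hz i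
      have hwi : 0 < w i := lt_of_le_of_ne (hw0 i) (Ne.symm (Finset.mem_filter.1 hi).2)
      -- A `1`-tree of positive weight lies in the support of `x`.
      have hFx : F ⊆ TSP.supportEdges x := by
        intro e he
        refine Finset.mem_filter.2 ⟨Finset.mem_univ e, ?_⟩
        have h1 : x e = ∑ j, w j * z j e := by
          rw [← hwz, Finset.sum_apply]
          rfl
        have h2 : w i * z i e ≤ ∑ j, w j * z j e := by
          refine Finset.single_le_sum (f := fun j => w j * z j e) (fun j _ => ?_)
            (Finset.mem_univ i)
          obtain ⟨G, -, -, hG⟩ := hz j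
          refine mul_nonneg (hw0 j) ?_
          rw [hG]
          exact Nat.cast_nonneg _
        have h3 : z i e = 1 := by simp [hzF, TSP.incidenceVector, TSP.setMultiplicity, he]
        rw [h3, mul_one] at h2
        linarith
      rw [hzF]
      refine TSP.add_mem_tourPolyhedron hF.connected y hy0 fun S hS => ?_
      rw [hy]
      exact TSP.one_le_sum_cut hx hhalf hA hFx hFC S hS
    have hsum1 : ∑ i ∈ Finset.univ.filter (fun i => w i ≠ 0), w i = 1 := by
      rw [Finset.sum_filter_ne_zero, hw1]
    have h1 := hT.sum_mem (fun i _ => hw0 i) hsum1 hmem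
    convert h1 using 1
    simp only [smul_add, Finset.sum_add_distrib]
    rw [← Finset.sum_smul, hsum1, one_smul, ← hwz]
    congr 1
    refine (Finset.sum_subset (Finset.filter_subset _ _) fun i _ hi => ?_).symm
    have : w i = 0 := by simpa using hi
    rw [this, zero_smul]
  have hHT : TSP.incidenceVector (TSP.setMultiplicity H) ∈ TSP.tourPolyhedron n :=
    subset_convexHull ℝ _ ⟨_, hA.isTour, rfl⟩
  have h1 := hT hHT hxy (a := 1 / 7) (b := 6 / 7) (by norm_num) (by norm_num) (by norm_num)
  convert h1 using 1
  funext e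
  simp only [hy, TSP.incidenceVector, Pi.add_apply, Pi.smul_apply, smul_eq_mul]
  ring
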